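/- Let $k$ be an algebraically closed field of characteristic $0$, and let $S=k[x_0,x_1,x_2,x_3]$ be the homogeneous coordinate ring of $\mathbb{P}^3=\mathbb{P}^3_k$. For a closed set $Z\subset\mathbb{P}^3$ (with its reduced structure) let $\mathscr{I}_Z$ be its ideal sheaf, so that $\mathrm{H}^0(\mathscr{I}_Z(d))$ is the space of forms of degree $d$ in $S$ vanishing on $Z$; the homogeneous ideal of $Z$ is the ideal of $S$ generated by all forms vanishing on $Z$. Let $L_1, L_2, L_3$ be three mutually disjoint lines in $\mathbb{P}^3$, let $Y=L_1\cup L_2\cup L_3$, and let $P_0,\ldots,P_3$ be four points of $\mathbb{P}^3$ such that $W=\{P_0,\ldots,P_3\}$ is not contained in a plane. Assume that none of the points $P_0,\ldots,P_3$ belongs to the quadric surface $Q\subset\mathbb{P}^3$ containing $Y$, and that $$\mathrm{H}^0\bigl(\mathscr{I}_{(Y\setminus L_l)\cup W}(2)\bigr)=0,\qquad l=1,2,3.$$ Let $P_4,P_5$ be two further points, lying on the line $L_1$ (the case $P_4=P_5$ is allowed), and put $W'=\{P_0,\ldots,P_5\}$. Then the homogeneous ideal of $L_2\cup L_3\cup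 W'$ is generated by cubic forms, that is, by homogeneous polynomials of degree $3$. -/

import Mathlib

open scoped LinearAlgebra.Projectivization

namespace LinesAndPoints

/-- The set of closed points of projective `3`-space over `k`. -/
abbrev P3 (k : Type*) [Field k] : Type _ := ℙ k (Fin 4 → k)

/-- The homogeneous coordinate ring of projective `3`-space over `k`. -/
abbrev S (k : Type*) [Field k] : Type _ := MvPolynomial (Fin 4) k

/-- A line in projective `3`-space: a linear subspace of projective dimension `1`. -/
def IsLine {k : Type*} [Field k] (L : Projectivization.Subspace k (Fin 4 → k)) : Prop :=
  Module.finrank k (Projectivization.Subspace.submodule L) = 2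

/-- A plane in projective `3`-space: a linear subspace of projective dimension `2`. -/
def IsPlane {k : Type*} [Field k] (H : Projectivization.Subspace k (Fin 4 → k)) : Prop :=
  Module.finrank k (Projectivization.Subspace.submodule H) = 3

/-- The polynomial `f` vanishes at the point `p`: it is zero at every vector of the
one-dimensional subspace `p` of `k⁴`. For a form it suffices to test one nonzero vector. -/
def VanishesAt {k : Type*} [Field k] (f : S k) (p : P3 k) : Prop :=
  ∀ v ∈ p.submodule, MvPolynomial.eval v f = 0

/-- A quadric surface: the set of zeros of a nonzero quadratic form. -/
def IsQuadricSurface {k : Type*} [Field k] (Q : Set (P3 k)) : Prop :=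
  ∃ q : S k, q ≠ 0 ∧ q.IsHomogeneous 2 ∧ Q = {p | VanishesAt q p}

/-- For a closed set `Z`, with its reduced structure and ideal sheaf `I_Z`, this is
`H⁰(I_Z(d))`: the space of forms of degree `d` that vanish at all points of `Z`. -/
noncomputable def formsVanishingOn {k : Type*} [Field k] (Z : Set (P3 k)) (d : ℕ) : Submodule k (S k) where
  carrier := {f | f.IsHomogeneous d ∧ ∀ p ∈ Z, VanishesAt f p}
  add_mem' := by
    rintro f g ⟨hf, hf'⟩ ⟨hg, hg'⟩
    refine ⟨hf.add hg, fun p hp v hv => ?_⟩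
    rw [map_add, hf' p hp v hv, hg' p hp v hv, add_zero]
  zero_mem' := ⟨MvPolynomial.isHomogeneous_zero _ _ _, fun p _ v _ => map_zero _⟩
  smul_mem' := by
    rintro c f ⟨hf, hf'⟩
    refine ⟨(MvPolynomial.homogeneousSubmodule (Fin 4) k d).smul_mem c hf, fun p hp v hv => ?_⟩
    rw [MvPolynomial.smul_eval, hf' p hp v hv, mul_zero]

/-- The homogeneous ideal of `Z`: the ideal of the homogeneous coordinate ring generated by the
forms of all degrees that vanish at all points of `Z`. -/
noncomputable def homogeneousIdeal {k : Type*} [Field k] (Z : Set (P3 k)) : Ideal (S k) :=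
  Ideal.span {f | ∃ d : ℕ, f ∈ formsVanishingOn Z d}

/-- The ideal `I` is generated by forms of degree `d`. -/
def IsGeneratedByForms {k : Type*} [Field k] (I : Ideal (S k)) (d : ℕ) : Prop :=
  ∃ G : Set (S k), (∀ g ∈ G, g.IsHomogeneous d) ∧ I = Ideal.span G

end LinesAndPoints

open scoped LinearAlgebra.Projectivization

namespace LinesAndPoints

open MvPolynomial

/-! Choose coordinates k⁴ = k² ⊕ k² with vectors (x, y), and put z = -(x + y), so that L₁, L₂, L₃
become z = 0, y = 0, x = 0 and the quadric becomes q = x ∧ y. The vanishing of the three spaces of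
quadrics says that a bilinear form in (y, z), in (x, z) or in (x, y) can be prescribed freely at P₀,
…, P₃. In particular no nonzero form of degree at most 2 vanishes on L₂ ∪ L₃ ∪ W.

Let f be a form of degree at least 3 in the ideal, and let K be generated by the cubics of the ideal
together with q. As q does not vanish on W, any cubic through L₂, L₃, P₄, P₅ can be moved through W
by subtracting a linear multiple of q, so it lies in K (`sub_mem_span_cubics`). Hence K contains all
products x_i y_j z_l, therefore all forms vanishing on the three lines (`mem_of_restrictZ_eq_zero`).
What remains is the restriction of f to L₁, a binary form divisible by the equations of P₄ and P₅,
and K contains cubics realising enough such restrictions. So f ∈ K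
(`mem_span_cubics_sup_of_isHomogeneous`).

Write f = g + c q with g in the ideal of the cubics. Then c vanishes on W, so c is a combination of
products N_i N_j with i ≠ j, where N is the basis of linear forms dual to the P_i. The crux is that
each q N_i N_j is a combination ∑ N_m t_m of cubics of the ideal
(`quad_mul_linForm_mul_linForm_mem`). -/

/-- A substitution which fixes the variables modulo an ideal fixes every polynomial modulo it. -/
theorem sub_mem_of_forall_X_sub_mem {σ R : Type*} [CommRing R]
    (φ : MvPolynomial σ R →ₐ[R] MvPolynomial σ R) (I : Ideal (MvPolynomial σ R))
    (h : ∀ i, X i - φ (X i) ∈ I) (f : MvPolynomial σ R) : f - φ f ∈ I := by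
  have : (Ideal.Quotient.mkₐ R I).comp φ = Ideal.Quotient.mkₐ R I := by
    refine MvPolynomial.algHom_ext fun i => ?_
    exact (Ideal.Quotient.eq.2 (h i)).symm
  exact Ideal.Quotient.eq.1 (DFunLike.congr_fun this f).symm

theorem eval_bind₁ {σ τ R : Type*} [CommRing R] (p : σ → MvPolynomial τ R) (v : τ → R)
    (f : MvPolynomial σ R) :
    eval v (bind₁ p f) = eval (fun i => eval v (p i)) f := by
  induction f using MvPolynomial.induction_on with
  | C a => simp
  | add f g hf hg => simp only [map_add, hf, hg]
  | mul_X f i hf => simp only [map_mul, hf, bind₁_X_right, eval_X]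

theorem homogeneousComponent_mul_of_isHomogeneous {σ R : Type*} [CommRing R] {m n : ℕ}
    {g : MvPolynomial σ R} (hg : g.IsHomogeneous m) (h : MvPolynomial σ R) :
    homogeneousComponent n (g * h) =
      if m ≤ n then g * homogeneousComponent (n - m) h else 0 := by
  let _ := gradedAlgebra (σ := σ) (R := R)
  have := DirectSum.coe_decompose_mul_of_left_mem (homogeneousSubmodule σ R) (b := h) n hg
  have hd : ∀ (φ : MvPolynomial σ R) (i : ℕ),
      (DirectSum.decompose (homogeneousSubmodule σ R) φ i : MvPolynomial σ R) =
        homogeneousComponent i φ := decomposition.decompose'_apply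
  rwa [hd, hd] at this

/-! ### Coordinates adapted to the three lines. -/

/-- The `x`-part of a vector `(x, y)`. -/
def partX {R : Type*} (v : Fin 4 → R) : Fin 2 → R := ![v 0, v 1]

/-- The `y`-part of a vector `(x, y)`. -/
def partY {R : Type*} (v : Fin 4 → R) : Fin 2 → R := ![v 2, v 3]

/-- The vector `z` with `x + y + z = 0` attached to a vector `(x, y)`. -/
def partZ {R : Type*} [CommRing R] (v : Fin 4 → R) : Fin 2 → R := ![-(v 0 + v 2), -(v 1 + v 3)]

/-- The determinant of two vectors in the plane. -/
def wedge {R : Type*} [CommRing R] (s t : Fin 2 → R) : R := s 0 * t 1 - s 1 * t 0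

/-- The bilinear form on the plane with the given coefficients. -/
def bil {R : Type*} [CommRing R] (M : Fin 4 → R) (s t : Fin 2 → R) : R :=
  M 0 * (s 0 * t 0) + M 1 * (s 0 * t 1) + M 2 * (s 1 * t 0) + M 3 * (s 1 * t 1)

/-- The equation of the quadric containing the lines `x = 0`, `y = 0` and `z = 0`. -/
def quad {R : Type*} [CommRing R] (v : Fin 4 → R) : R := v 0 * v 3 - v 1 * v 2

variable {k : Type*} [Field k]

/-- Vanishing along the lines `y = 0` and `x = 0`. -/
def VanishesOnAxes (f : S k) : Prop :=
  (∀ v : Fin 4 → k, v 2 = 0 → v 3 = 0 → eval v f = 0) ∧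
    ∀ v : Fin 4 → k, v 0 = 0 → v 1 = 0 → eval v f = 0

/-- The cubic forms vanishing along the lines `x = 0`, `y = 0` and at given vectors. -/
def cubics (P : Fin 4 → Fin 4 → k) (u v : Fin 4 → k) : Set (S k) :=
  {g | g.IsHomogeneous 3 ∧ VanishesOnAxes g ∧ (∀ i, eval (P i) g = 0) ∧
    eval u g = 0 ∧ eval v g = 0}

theorem isHomogeneous_partX (i : Fin 2) : (partX (X : Fin 4 → S k) i).IsHomogeneous 1 := by
  fin_cases i <;> exact isHomogeneous_X _ _

theorem isHomogeneous_partY (i : Fin 2) : (partY (X : Fin 4 → S k) i).IsHomogeneous 1 := by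
  fin_cases i <;> exact isHomogeneous_X _ _

theorem isHomogeneous_partZ (i : Fin 2) : (partZ (X : Fin 4 → S k) i).IsHomogeneous 1 := by
  fin_cases i <;> exact ((isHomogeneous_X _ _).add (isHomogeneous_X _ _)).neg

theorem isHomogeneous_quad : (quad X : S k).IsHomogeneous 2 :=
  ((isHomogeneous_X _ _).mul (isHomogeneous_X _ _)).sub
    ((isHomogeneous_X _ _).mul (isHomogeneous_X _ _))

theorem isHomogeneous_wedge {s t : Fin 2 → S k} {m n : ℕ} (hs : ∀ i, (s i).IsHomogeneous m)
    (ht : ∀ i, (t i).IsHomogeneous n) : (wedge s t).IsHomogeneous (m + n) :=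
  ((hs 0).mul (ht 1)).sub ((hs 1).mul (ht 0))

theorem eval_bil (v : Fin 4 → k) (c : Fin 4 → k) (s t : Fin 2 → S k) :
    eval v (bil (C ∘ c) s t) = bil c (fun i => eval v (s i)) (fun i => eval v (t i)) := by
  simp [bil]

theorem eval_partX (v : Fin 4 → k) : (fun i => eval v (partX (X : Fin 4 → S k) i)) = partX v := by
  funext i; fin_cases i <;> simp [partX]

theorem eval_partY (v : Fin 4 → k) : (fun i => eval v (partY (X : Fin 4 → S k) i)) = partY v := by
  funext i; fin_cases i <;> simp [partY]

theorem eval_partZ (v : Fin 4 → k) : (fun i => eval v (partZ (X : Fin 4 → S k) i)) = partZ v := by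
  funext i; fin_cases i <;> simp [partZ]

theorem isHomogeneous_bil (c : Fin 4 → k) {s t : Fin 2 → S k} (hs : ∀ i, (s i).IsHomogeneous 1)
    (ht : ∀ i, (t i).IsHomogeneous 1) : (bil (C ∘ c) s t).IsHomogeneous 2 :=
  (((((hs 0).mul (ht 0)).C_mul _).add (((hs 0).mul (ht 1)).C_mul _)).add
    (((hs 1).mul (ht 0)).C_mul _)).add (((hs 1).mul (ht 1)).C_mul _)

theorem eval_quad (v : Fin 4 → k) : eval v (quad X : S k) = quad v := by
  simp [quad]

theorem eq_neg_of_partZ_eq_zero {v : Fin 4 → k} (hv : partZ v = 0) :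
    v 2 = -v 0 ∧ v 3 = -v 1 := by
  have h0 := congrFun hv 0
  have h1 := congrFun hv 1
  simp only [partZ, Matrix.cons_val_zero, Matrix.cons_val_one, Pi.zero_apply] at h0 h1
  exact ⟨by linear_combination -h0, by linear_combination -h1⟩

theorem quad_eq_zero_of_partZ_eq_zero {v : Fin 4 → k} (hv : partZ v = 0) : quad v = 0 := by
  obtain ⟨h2, h3⟩ := eq_neg_of_partZ_eq_zero hv
  rw [quad, h2, h3]
  ring

/-! ### Forms vanishing on two or three of the lines. -/

theorem exists_eq_of_vanishesOnAxes [Infinite k] {f : S k} (hf : VanishesOnAxes f) :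
    ∃ g : Fin 2 → Fin 2 → S k, f = X 0 * X 2 * g 0 0 + X 0 * X 3 * g 0 1 + X 1 * X 2 * g 1 0
      + X 1 * X 3 * g 1 1 := by
  obtain ⟨hy, hx⟩ := hf
  set φ : S k →ₐ[k] S k := bind₁ ![X 0, X 1, 0, 0]
  set ψ : S k →ₐ[k] S k := bind₁ ![0, 0, X 2, X 3]
  have hφ : φ f = 0 := MvPolynomial.funext fun v => by
    rw [eval_bind₁, map_zero]; exact hy _ (by simp) (by simp)
  have hψ : ψ f = 0 := MvPolynomial.funext fun v => by
    rw [eval_bind₁, map_zero]; exact hx _ (by simp) (by simp)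
  have h1 : f - φ f ∈ Ideal.span {X 2, X 3} := by
    refine sub_mem_of_forall_X_sub_mem φ _ (fun i => ?_) f
    fin_cases i <;> simp [φ] <;> exact Ideal.subset_span (by simp)
  rw [hφ, sub_zero] at h1
  obtain ⟨a, b, hab⟩ := Ideal.mem_span_pair.1 h1
  have h2 : ∀ p : S k, p - ψ p ∈ Ideal.span {X 0, X 1} := by
    refine sub_mem_of_forall_X_sub_mem ψ _ (fun i => ?_)
    fin_cases i <;> simp [ψ] <;> exact Ideal.subset_span (by simp)
  obtain ⟨a0, a1, ha⟩ := Ideal.mem_span_pair.1 (h2 a)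
  obtain ⟨b0, b1, hb⟩ := Ideal.mem_span_pair.1 (h2 b)
  -- Setting x = 0 in f = a y₀ + b y₁ allows a and b to be replaced by a - ψ a and b - ψ b, which
  -- lie in the ideal of the x-variables.
  have h3 : ψ a * X 2 + ψ b * X 3 = 0 := by
    rw [← hψ, ← hab]; simp [ψ]
  refine ⟨![![a0, b0], ![a1, b1]], ?_⟩
  simp only [Matrix.cons_val_zero, Matrix.cons_val_one]
  linear_combination -hab + h3 - X 2 * ha - X 3 * hb

/-- Restriction to the line `z = 0`. -/
noncomputable def restrictZ : S k →ₐ[k] S k := bind₁ ![X 0, X 1, -X 0, -X 1]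

theorem eval_restrictZ (v : Fin 4 → k) (f : S k) :
    eval v (restrictZ f) = eval ![v 0, v 1, -v 0, -v 1] f := by
  rw [restrictZ, eval_bind₁]
  congr 2
  funext i
  fin_cases i <;> simp

/-- Syzygies of two distinct variables are Koszul, because a variable is prime. -/
theorem X_dvd_of_mul_eq {σ : Type*} {i j : σ} (hij : i ≠ j) {a b : MvPolynomial σ k}
    (h : X i * a + X j * b = 0) : ∃ c, a = X j * c ∧ b = -(X i * c) := by
  have hd : X j ∣ X i * a := ⟨-b, by linear_combination h⟩
  have hp : Prime (X j : MvPolynomial σ k) := X_prime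
  rcases hp.dvd_or_dvd hd with hd | ⟨c, hc⟩
  · exact absurd (X_dvd_X.1 hd).symm hij
  · refine ⟨c, hc, ?_⟩
    have : X j * (b + X i * c) = 0 := by rw [hc] at h; linear_combination h
    rcases mul_eq_zero.1 this with h0 | h0
    · exact absurd h0 hp.ne_zero
    · linear_combination h0

/-- An ideal containing the quadric and the products `x i * y j * z l` contains every form
vanishing on the three lines. -/
theorem mem_of_restrictZ_eq_zero [Infinite k] {K : Ideal (S k)} (hq : quad X ∈ K)
    (hK : ∀ i j l, partX X i * partY X j * partZ X l ∈ K) {f : S k} (hf : VanishesOnAxes f)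
    (hz : restrictZ f = 0) : f ∈ K := by
  obtain ⟨g, hg⟩ := exists_eq_of_vanishesOnAxes hf
  have h1 : ∀ p : S k, p - restrictZ p ∈ Ideal.span {partZ X 0, partZ X 1} := by
    refine sub_mem_of_forall_X_sub_mem _ _ (fun i => ?_)
    rw [Ideal.mem_span_pair]
    fin_cases i
    · exact ⟨0, 0, by simp [restrictZ]⟩
    · exact ⟨0, 0, by simp [restrictZ]⟩
    · exact ⟨-1, 0, by simp [restrictZ, partZ]; ring⟩
    · exact ⟨0, -1, by simp [restrictZ, partZ]; ring⟩
  have h2 : ∀ i j (p : S k), partX X i * partY X j * (p - restrictZ p) ∈ K := by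
    intro i j p
    obtain ⟨a, b, hab⟩ := Ideal.mem_span_pair.1 (h1 p)
    have := K.add_mem (K.mul_mem_left a (hK i j 0)) (K.mul_mem_left b (hK i j 1))
    rw [← hab]
    convert! this using 1
    ring
  -- On z = 0 one has y = -x, so the vanishing restriction of f = ∑ x_i y_j g_ij is a syzygy of x₀,
  -- x₁; its Koszul coefficient c is the multiple of the quadric to be removed.
  have h3 : X 0 * (X 0 * restrictZ (g 0 0) + X 1 * restrictZ (g 1 0)) +
      X 1 * (X 0 * restrictZ (g 0 1) + X 1 * restrictZ (g 1 1)) = 0 := by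
    rw [hg] at hz
    simp [restrictZ] at hz
    simp only [restrictZ]
    linear_combination -hz
  obtain ⟨c, hc0, hc1⟩ := X_dvd_of_mul_eq (by decide) h3
  have h4 : f = partX X 0 * partY X 0 * (g 0 0 - restrictZ (g 0 0))
      + partX X 0 * partY X 1 * (g 0 1 - restrictZ (g 0 1))
      + partX X 1 * partY X 0 * (g 1 0 - restrictZ (g 1 0))
      + partX X 1 * partY X 1 * (g 1 1 - restrictZ (g 1 1)) + -c * quad X := by
    simp only [partX, partY, quad, Matrix.cons_val_zero, Matrix.cons_val_one]
    linear_combination hg + X 2 * hc0 + X 3 * hc1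
  rw [h4]
  exact K.add_mem (K.add_mem (K.add_mem (K.add_mem (h2 _ _ _) (h2 _ _ _)) (h2 _ _ _))
    (h2 _ _ _)) (K.mul_mem_left _ hq)

/-! ### The ideal of four independent points. -/

/-- The linear form with the given coefficients. -/
noncomputable def linForm {n : Type*} [Fintype n] (c : n → k) : MvPolynomial n k :=
  ∑ m, C (c m) * X m

theorem isHomogeneous_linForm {n : Type*} [Fintype n] (c : n → k) :
    (linForm c).IsHomogeneous 1 :=
  IsHomogeneous.sum _ _ _ fun _ _ => isHomogeneous_C_mul_X _ _

theorem eval_linForm {n : Type*} [Fintype n] (c v : n → k) :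
    eval v (linForm c) = ∑ m, c m * v m := by
  simp [linForm]

/-- Restriction to the line through the origin and `P i`. -/
noncomputable def restrictPoint {n : Type*} [Fintype n] (P N : Matrix n n k) (i : n) :
    MvPolynomial n k →ₐ[k] MvPolynomial n k :=
  bind₁ fun m => C (P i m) * linForm (N i)

theorem eval_restrictPoint {n : Type*} [Fintype n] {P N : Matrix n n k} (i : n) (v : n → k) (f : MvPolynomial n k) :
    eval v (restrictPoint P N i f) = eval ((eval v (linForm (N i))) • P i) f := by
  rw [restrictPoint, eval_bind₁]
  congr 2
  funext m
  simp [mul_comm]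

section Coordinates

variable {n : Type*} [Fintype n] [DecidableEq n] {P N : Matrix n n k}

theorem eval_linForm_of_mul_eq_one (h : N * P.transpose = 1) (i r : n) :
    eval (P r) (linForm (N i)) = if i = r then 1 else 0 := by
  have := congrFun (congrFun h i) r
  rw [Matrix.mul_apply, Matrix.one_apply] at this
  rw [eval_linForm, ← this]
  rfl

theorem sum_mul_linForm (h : N * P.transpose = 1) (m : n) :
    ∑ j, C (P j m) * linForm (N j) = X m := by
  have h' : P.transpose * N = 1 := mul_eq_one_comm.1 h
  have : ∀ l, ∑ j, P j m * N j l = if m = l then 1 else 0 := fun l => by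
    have := congrFun (congrFun h' m) l
    rwa [Matrix.mul_apply, Matrix.one_apply] at this
  calc ∑ j, C (P j m) * linForm (N j) = ∑ l, C (∑ j, P j m * N j l) * X l := by
        simp only [linForm, Finset.mul_sum, map_sum, Finset.sum_mul, map_mul]
        rw [Finset.sum_comm]
        simp only [mul_assoc]
    _ = X m := by simp [this]

/-- A polynomial vanishing on the coordinate axes lies in the ideal generated by the products of
two different coordinates. -/
theorem mem_span_of_restrictPoint_eq_zero (h : N * P.transpose = 1) {f : MvPolynomial n k}
    (h0 : eval 0 f = 0) (hf : ∀ i, restrictPoint P N i f = 0) :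
    f ∈ Ideal.span {g | ∃ i j, i ≠ j ∧ g = linForm (N i) * linForm (N j)} := by
  set J := Ideal.span {g | ∃ i j, i ≠ j ∧ g = linForm (N i) * linForm (N j)}
  -- Modulo J, a polynomial is its constant term plus the nonconstant parts of its restrictions to
  -- the axes.
  have key : ∀ p : MvPolynomial n k,
      p - C (eval 0 p) - ∑ i, (restrictPoint P N i p - C (eval 0 p)) ∈ J := by
    intro p
    induction p using MvPolynomial.induction_on with
    | C a => simp [restrictPoint]
    | add p q hp hq =>
      convert! J.add_mem hp hq using 1
      simp only [map_add, Finset.sum_sub_distrib, Finset.sum_add_distrib]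
      ring
    | mul_X p m _ =>
      -- Only the factor `X m` is expanded in the dual basis; p minus its restriction to axis i then
      -- lies in the ideal of the N_j with j ≠ i.
      have h1 : p * X m - C (eval 0 (p * X m)) -
          ∑ i, (restrictPoint P N i (p * X m) - C (eval 0 (p * X m))) =
          ∑ i, C (P i m) * (linForm (N i) * (p - restrictPoint P N i p)) := by
        conv_lhs => enter [1, 1]; rw [← sum_mul_linForm h m]
        simp only [map_mul, eval_X, Pi.zero_apply, mul_zero, map_zero, sub_zero, Finset.mul_sum,
          ← Finset.sum_sub_distrib]
        refine Finset.sum_congr rfl fun i _ => ?_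
        simp only [restrictPoint, bind₁_X_right]
        ring
      rw [h1]
      refine J.sum_mem fun i _ => J.mul_mem_left _ ?_
      have h2 : p - restrictPoint P N i p ∈
          Ideal.span ((fun j => linForm (N j)) '' {j | i ≠ j}) := by
        refine sub_mem_of_forall_X_sub_mem _ _ (fun l => ?_) p
        have : X l - restrictPoint P N i (X l) =
            ∑ j ∈ Finset.univ.erase i, C (P j l) * linForm (N j) := by
          rw [← sum_mul_linForm h l, Finset.sum_erase_eq_sub (Finset.mem_univ i),
            sum_mul_linForm h l]
          simp [restrictPoint]
        rw [this]
        refine Ideal.sum_mem _ fun j hj => Ideal.mul_mem_left _ _ (Ideal.subset_span ⟨j, ?_, rfl⟩)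
        exact (Finset.ne_of_mem_erase hj).symm
      refine Submodule.span_induction (p := fun q _ => linForm (N i) * q ∈ J) ?_ ?_ ?_ ?_ h2
      · rintro _ ⟨j, hj, rfl⟩
        exact Ideal.subset_span ⟨i, j, hj, rfl⟩
      · simp
      · intro a b _ _ ha hb
        rw [mul_add]
        exact J.add_mem ha hb
      · intro a b _ hb
        rw [smul_eq_mul, mul_left_comm]
        exact J.mul_mem_left _ hb
  have := key f
  simpa only [h0, hf, map_zero, sub_zero, Finset.sum_const_zero] using this

end Coordinates

/-! ### Multiples of the quadric and the ideal of the cubics. -/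

theorem sub_mem_span_cubics {P N : Matrix (Fin 4) (Fin 4) k} (hN : N * P.transpose = 1)
    (hP : ∀ i, quad (P i) ≠ 0) {u v : Fin 4 → k} (hu : partZ u = 0) (hv : partZ v = 0) {e : S k}
    (he : e.IsHomogeneous 3) (hax : VanishesOnAxes e) (heu : eval u e = 0) (hev : eval v e = 0) :
    e ∈ Ideal.span (cubics P u v) ⊔ Ideal.span {quad X} := by
  -- The linear form interpolating e / q at the four points, so that e - l q vanishes there.
  set l : S k := ∑ i, C (eval (P i) e / quad (P i)) * linForm (N i) with hl
  have hl1 : l.IsHomogeneous 1 := IsHomogeneous.sum _ _ _ fun i _ =>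
    (isHomogeneous_linForm _).C_mul _
  have hlP : ∀ r, eval (P r) l = eval (P r) e / quad (P r) := fun r => by
    simp [hl, eval_linForm_of_mul_eq_one hN]
  have : e - l * quad X ∈ Ideal.span (cubics P u v) := by
    refine Ideal.subset_span ⟨he.sub (hl1.mul isHomogeneous_quad), ⟨?_, ?_⟩, fun i => ?_, ?_, ?_⟩
    · intro w h2 h3
      simp [hax.1 w h2 h3, quad, h2, h3]
    · intro w h2 h3
      simp [hax.2 w h2 h3, quad, h2, h3]
    · simp [hlP, eval_quad, hP i]
    · simp [heu, eval_quad, quad_eq_zero_of_partZ_eq_zero hu]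
    · simp [hev, eval_quad, quad_eq_zero_of_partZ_eq_zero hv]
  rw [← sub_add_cancel e (l * quad X)]
  exact Submodule.add_mem_sup this (Ideal.mul_mem_left _ _ (Ideal.mem_span_singleton_self _))

/-- The scalar identity expressing a linear form vanishing at `p` by the three pencils of planes
through `p`. -/
theorem quad_mul_eq (c p v : Fin 4 → k) (h : ∑ m, c m * p m = 0) :
    quad p * ∑ m, c m * v m =
      (-(c 0 * p 2 + c 1 * p 3) - (c 0 * p 0 + c 1 * p 1)) * wedge (partX v) (partX p)
      + (c 2 * p 0 + c 3 * p 1 - (c 0 * p 0 + c 1 * p 1)) * wedge (partY v) (partY p)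
      + (c 0 * p 0 + c 1 * p 1) * wedge (partZ v) (partZ p) := by
  -- With c read as a functional and p = (x_p, y_p), the coefficients are c(z_p, 0), -c(0, z_p)
  -- (using `h`) and c(x_p, 0).
  simp only [Fin.sum_univ_four] at h ⊢
  simp only [quad, wedge, partX, partY, partZ, Matrix.cons_val_zero, Matrix.cons_val_one]
  linear_combination (p 0 * v 3 - p 1 * v 2) * h

/-- As N_j vanishes at P_i, the form q(P_i) N_j is a combination of x ∧ x(P_i), y ∧ y(P_i), z ∧
z(P_i). Multiplying such planes by the bilinear forms `A i`, `B i`, `D i`, which vanish at the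
points other than P_i, gives cubics through all three lines that cancel the value of q N_i at P_i.
-/
theorem quad_mul_linForm_mul_linForm_mem {P N : Matrix (Fin 4) (Fin 4) k}
    (hN : N * P.transpose = 1) {A B D : Fin 4 → Fin 4 → k}
    (hA : ∀ i r, bil (A i) (partY (P r)) (partZ (P r)) = if i = r then 1 else 0)
    (hB : ∀ i r, bil (B i) (partX (P r)) (partZ (P r)) = if i = r then 1 else 0)
    (hD : ∀ i r, bil (D i) (partX (P r)) (partY (P r)) = if i = r then 1 else 0)
    {u v : Fin 4 → k} (hu : partZ u = 0) (hv : partZ v = 0) {i j : Fin 4} (hij : i ≠ j) :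
    quad X * (linForm (N i) * linForm (N j)) ∈ Ideal.span (cubics P u v) := by
  have hji : ∑ m, N j m * P i m = 0 := by
    rw [← eval_linForm, eval_linForm_of_mul_eq_one hN, if_neg hij.symm]
  obtain ⟨α, β, γ, hαβγ⟩ : ∃ α β γ : k, ∀ v, quad (P i) * ∑ m, N j m * v m =
      α * wedge (partX v) (partX (P i)) + β * wedge (partY v) (partY (P i))
      + γ * wedge (partZ v) (partZ (P i)) := ⟨_, _, _, fun v => quad_mul_eq _ _ v hji⟩
  -- Each correction term has one factor in each of x, y, z, hence vanishes on the three lines. At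
  -- P_r with r ≠ i every term is zero; at P_i the terms cancel by `hαβγ` evaluated at P_m.
  let t : Fin 4 → S k := fun m => C (if j = m then 1 else 0) * (quad X * linForm (N i))
    - C α * (wedge (C ∘ partX (P m)) (partX X) * bil (C ∘ A i) (partY X) (partZ X))
    - C β * (wedge (C ∘ partY (P m)) (partY X) * bil (C ∘ B i) (partX X) (partZ X))
    - C γ * (wedge (C ∘ partZ (P m)) (partZ X) * bil (C ∘ D i) (partX X) (partY X))
  have hw : ∀ (c : Fin 2 → k) (s : Fin 2 → S k), (∀ i, (s i).IsHomogeneous 1) →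
      (wedge (C ∘ c) s).IsHomogeneous 1 := fun c s hs =>
    isHomogeneous_wedge (s := C ∘ c) (m := 0) (fun i => isHomogeneous_C _ (c i)) hs
  have ew : ∀ (v : Fin 4 → k) (c : Fin 2 → k) (s : Fin 2 → S k),
      eval v (wedge (C ∘ c) s) = wedge c (fun i => eval v (s i)) := fun v c s => by simp [wedge]
  have et : ∀ m v, eval v (t m) = (if j = m then 1 else 0) * (quad v * eval v (linForm (N i)))
      - α * (wedge (partX (P m)) (partX v) * bil (A i) (partY v) (partZ v))
      - β * (wedge (partY (P m)) (partY v) * bil (B i) (partX v) (partZ v))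
      - γ * (wedge (partZ (P m)) (partZ v) * bil (D i) (partX v) (partY v)) := fun m v => by
    simp only [t, map_sub, map_mul, eval_C, eval_quad, ew, eval_bil, eval_partX, eval_partY,
      eval_partZ]
  have hz : ∀ m (v : Fin 4 → k), partZ v = 0 → eval v (t m) = 0 := by
    intro m v hv
    rw [et, hv]
    simp [quad_eq_zero_of_partZ_eq_zero hv, bil, wedge]
  have ht : ∀ m, t m ∈ cubics P u v := by
    intro m
    refine ⟨?_, ⟨?_, ?_⟩, fun r => ?_, hz m u hu, hz m v hv⟩
    · exact ((((isHomogeneous_quad.mul (isHomogeneous_linForm _)).C_mul _).sub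
        (((hw _ _ isHomogeneous_partX).mul (isHomogeneous_bil _ isHomogeneous_partY isHomogeneous_partZ)).C_mul _)).sub
        (((hw _ _ isHomogeneous_partY).mul (isHomogeneous_bil _ isHomogeneous_partX isHomogeneous_partZ)).C_mul _)).sub
        (((hw _ _ isHomogeneous_partZ).mul (isHomogeneous_bil _ isHomogeneous_partX isHomogeneous_partY)).C_mul _)
    · intro v h2 h3
      have : partY v = 0 := by funext i; fin_cases i <;> simp [partY, h2, h3]
      rw [et, this]
      simp [bil, wedge, quad, h2, h3]
    · intro v h2 h3
      have : partX v = 0 := by funext i; fin_cases i <;> simp [partX, h2, h3]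
      rw [et, this]
      simp [bil, wedge, quad, h2, h3]
    · rw [et, hA, hB, hD, eval_linForm_of_mul_eq_one hN]
      rcases eq_or_ne i r with rfl | h
      · have := hαβγ (P m)
        rw [← eval_linForm, eval_linForm_of_mul_eq_one hN] at this
        simp only [if_true, mul_one]
        linear_combination this
      · simp [h]
  -- Since ∑ N_m P_m is the generic vector, the corrections sum to multiples of x ∧ x, y ∧ y, z ∧ z,
  -- all zero.
  have hsum : quad X * (linForm (N i) * linForm (N j)) = ∑ m, linForm (N m) * t m := by
    have hs : ∀ l : Fin 4, ∑ m, linForm (N m) * C (P m l) = X l := fun l => by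
      rw [← sum_mul_linForm hN l]
      simp only [mul_comm]
    have h0 := hs 0
    have h1 := hs 1
    have h2 := hs 2
    have h3 := hs 3
    have hd : ∑ m, linForm (N m) * C (if j = m then 1 else 0) = linForm (N j) := by
      simp
    simp only [t, Fin.sum_univ_four] at h0 h1 h2 h3 hd ⊢
    generalize bil (C ∘ A i) (partY X) (partZ X) = a
    generalize bil (C ∘ B i) (partX X) (partZ X) = b
    generalize bil (C ∘ D i) (partX X) (partY X) = d
    simp only [wedge, partX, partY, partZ, Matrix.cons_val_zero, Matrix.cons_val_one,
      Function.comp, map_neg, map_add]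
    linear_combination -(quad X * linForm (N i)) * hd + C α * a * (X 1 * h0 - X 0 * h1)
      + C β * b * (X 3 * h2 - X 2 * h3)
      + C γ * d * ((X 1 + X 3) * (h0 + h2) - (X 0 + X 2) * (h1 + h3))
  rw [hsum]
  exact Ideal.sum_mem _ fun m _ => Ideal.mul_mem_left _ _ (Ideal.subset_span (ht m))

/-! ### Binary forms on the line z = 0, encoded as polynomials fixed by `restrictZ`. -/

theorem eval_smul_of_isHomogeneous {σ : Type*} {f : MvPolynomial σ k} {n : ℕ}
    (hf : f.IsHomogeneous n) (t : k) (v : σ → k) : eval (t • v) f = t ^ n * eval v f := by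
  rw [eval_eq, eval_eq, Finset.mul_sum]
  refine Finset.sum_congr rfl fun d hd => ?_
  rw [hf.degree_eq_sum_deg_support hd, ← Finset.prod_pow_eq_pow_sum]
  simp only [Pi.smul_apply, smul_eq_mul, mul_pow, Finset.prod_mul_distrib]
  ring

theorem isHomogeneous_restrictZ {f : S k} {n : ℕ} (hf : f.IsHomogeneous n) :
    (restrictZ f).IsHomogeneous n := by
  have := hf.aeval (S := k) ![(X 0 : S k), X 1, -X 0, -X 1] (n := 1) fun i => by
    fin_cases i
    · exact isHomogeneous_X _ _
    · exact isHomogeneous_X _ _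
    · exact (isHomogeneous_X _ _).neg
    · exact (isHomogeneous_X _ _).neg
  rwa [one_mul] at this

theorem restrictZ_restrictZ (f : S k) : restrictZ (restrictZ f) = restrictZ f := by
  have : (restrictZ (k := k)).comp restrictZ = restrictZ := by
    refine MvPolynomial.algHom_ext fun i => ?_
    fin_cases i <;> simp [restrictZ]
  exact DFunLike.congr_fun this f

theorem restrictZ_wedge (c : Fin 2 → k) :
    restrictZ (wedge (partX X) (C ∘ c)) = wedge (partX X) (C ∘ c) := by
  simp [restrictZ, wedge, partX]

/-- A binary form vanishing at a point is divisible by the linear form of that point. -/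
theorem exists_eq_wedge_mul [Infinite k] {F : S k} {n : ℕ} (hF : F.IsHomogeneous (n + 1))
    (hr : restrictZ F = F) {u : Fin 4 → k} (hu : partZ u = 0) (hu0 : partX u ≠ 0)
    (hFu : eval u F = 0) :
    ∃ G : S k, G.IsHomogeneous n ∧ restrictZ G = G ∧ F = wedge (partX X) (C ∘ partX u) * G := by
  obtain ⟨s, hs⟩ : ∃ s : Fin 2 → k, s 0 * u 0 + s 1 * u 1 = 1 := by
    by_cases h : u 0 = 0
    · refine ⟨![0, (u 1)⁻¹], ?_⟩
      have h1 : u 1 ≠ 0 := fun h1 => hu0 (by funext i; fin_cases i <;> simp [partX, h, h1])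
      simp [h1]
    · exact ⟨![(u 0)⁻¹, 0], by simp [h]⟩
  obtain ⟨h2, h3⟩ := eq_neg_of_partZ_eq_zero hu
  -- On the x-variables this is the projection x ↦ s(x) u onto the line of u, where s(u) = 1; it
  -- kills F by homogeneity.
  let ψ : S k →ₐ[k] S k := bind₁ ![C (u 0) * (C (s 0) * X 0 + C (s 1) * X 1),
    C (u 1) * (C (s 0) * X 0 + C (s 1) * X 1), X 2, X 3]
  have hψ : ψ F = 0 := MvPolynomial.funext fun v => by
    rw [eval_bind₁, map_zero, ← hr, eval_restrictZ]
    have : (![u 0 * (s 0 * v 0 + s 1 * v 1), u 1 * (s 0 * v 0 + s 1 * v 1),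
        -(u 0 * (s 0 * v 0 + s 1 * v 1)), -(u 1 * (s 0 * v 0 + s 1 * v 1))] : Fin 4 → k) =
        (s 0 * v 0 + s 1 * v 1) • u := by
      funext i
      fin_cases i <;> simp [h2, h3, mul_comm]
    simp only [Matrix.cons_val_zero, Matrix.cons_val_one, map_mul, map_add, eval_C, eval_X]
    rw [this, eval_smul_of_isHomogeneous hF, hFu, mul_zero]
  have hs' : (C (s 0) * C (u 0) + C (s 1) * C (u 1) : S k) = 1 := by
    rw [← map_mul, ← map_mul, ← map_add, hs, map_one]
  have h2 : F - ψ F ∈ Ideal.span {wedge (partX X) (C ∘ partX u)} := by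
    refine sub_mem_of_forall_X_sub_mem ψ _ (fun i => ?_) F
    rw [Ideal.mem_span_singleton']
    fin_cases i
    · refine ⟨C (s 1), ?_⟩
      simp only [wedge, partX, ψ, Matrix.cons_val_zero, Matrix.cons_val_one, Function.comp,
        bind₁_X_right, Fin.zero_eta]
      linear_combination X 0 * hs'
    · refine ⟨-C (s 0), ?_⟩
      simp only [wedge, partX, ψ, Matrix.cons_val_zero, Matrix.cons_val_one, Function.comp,
        bind₁_X_right, Fin.mk_one]
      linear_combination X 1 * hs'
    · exact ⟨0, by simp [ψ]⟩
    · exact ⟨0, by simp [ψ]⟩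
  rw [hψ, sub_zero, Ideal.mem_span_singleton] at h2
  obtain ⟨G, hG⟩ := h2
  have hl : (wedge (partX X) (C ∘ partX u) : S k).IsHomogeneous 1 :=
    isHomogeneous_wedge isHomogeneous_partX fun i => isHomogeneous_C _ (partX u i)
  refine ⟨restrictZ (homogeneousComponent n G),
    isHomogeneous_restrictZ (homogeneousComponent_isHomogeneous _ _), restrictZ_restrictZ _, ?_⟩
  conv_lhs => rw [← hr, ← homogeneousComponent_eq_self hF, hG,
    homogeneousComponent_mul_of_isHomogeneous hl, if_pos (by omega), map_mul, restrictZ_wedge]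
  simp

/-- A binary form of positive degree lies in the ideal of the variables. -/
theorem exists_eq_X_mul_add [Infinite k] {F : S k} {n : ℕ} (hF : F.IsHomogeneous (n + 1))
    (hr : restrictZ F = F) : ∃ G : Fin 2 → S k, (∀ i, (G i).IsHomogeneous n) ∧
      (∀ i, restrictZ (G i) = G i) ∧ F = X 0 * G 0 + X 1 * G 1 := by
  let ψ : S k →ₐ[k] S k := bind₁ ![0, 0, X 2, X 3]
  have hψ : ψ F = 0 := MvPolynomial.funext fun v => by
    rw [eval_bind₁, map_zero, ← hr, eval_restrictZ]
    have := eval_smul_of_isHomogeneous hF 0 0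
    rw [zero_pow (by omega), zero_mul, zero_smul] at this
    rw [← this]
    congr 2
    funext i
    fin_cases i <;> simp
  have h2 : F - ψ F ∈ Ideal.span {X 0, X 1} := by
    refine sub_mem_of_forall_X_sub_mem ψ _ (fun i => ?_) F
    fin_cases i <;> simp [ψ] <;> exact Ideal.subset_span (by simp)
  rw [hψ, sub_zero] at h2
  obtain ⟨a, b, hab⟩ := Ideal.mem_span_pair.1 h2
  refine ⟨![restrictZ (homogeneousComponent n a), restrictZ (homogeneousComponent n b)],
    fun i => ?_, fun i => ?_, ?_⟩
  · fin_cases i <;> exact isHomogeneous_restrictZ (homogeneousComponent_isHomogeneous _ _)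
  · fin_cases i <;> exact restrictZ_restrictZ _
  · conv_lhs => rw [← hr, ← homogeneousComponent_eq_self hF, ← hab, map_add, mul_comm a,
      mul_comm b, homogeneousComponent_mul_of_isHomogeneous (isHomogeneous_X _ _),
      homogeneousComponent_mul_of_isHomogeneous (isHomogeneous_X _ _), if_pos (by omega),
      if_pos (by omega)]
    simp [restrictZ]

theorem vanishesOnAxes_mul_left {f : S k} (hf : VanishesOnAxes f) (g : S k) :
    VanishesOnAxes (f * g) :=
  ⟨fun v h2 h3 => by rw [map_mul, hf.1 v h2 h3, zero_mul],
    fun v h0 h1 => by rw [map_mul, hf.2 v h0 h1, zero_mul]⟩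

theorem vanishesOnAxes_X_mul_X (i j : Fin 2) :
    VanishesOnAxes (partX X i * partY X j : S k) := by
  constructor
  · intro v h2 h3
    fin_cases j <;> simp [partY, h2, h3]
  · intro v h0 h1
    fin_cases i <;> simp [partX, h0, h1]

theorem vanishesOnAxes_add {f g : S k} (hf : VanishesOnAxes f) (hg : VanishesOnAxes g) :
    VanishesOnAxes (f + g) :=
  ⟨fun v h2 h3 => by rw [map_add, hf.1 v h2 h3, hg.1 v h2 h3, zero_add],
    fun v h0 h1 => by rw [map_add, hf.2 v h0 h1, hg.2 v h0 h1, zero_add]⟩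

theorem vanishesOnAxes_neg {f : S k} (hf : VanishesOnAxes f) : VanishesOnAxes (-f) :=
  ⟨fun v h2 h3 => by rw [map_neg, hf.1 v h2 h3, neg_zero],
    fun v h0 h1 => by rw [map_neg, hf.2 v h0 h1, neg_zero]⟩

/-! ### Reduction modulo the quadric. -/

section

variable {P N : Matrix (Fin 4) (Fin 4) k} {u v : Fin 4 → k}

/-- These cubics lift to space the binary cubics through u and v: since y = -x on z = 0, the first
factor vanishes at u, and also at v when u and v are proportional; otherwise r takes care of v. -/
theorem wedge_mul_mem (hN : N * P.transpose = 1) (hP : ∀ i, quad (P i) ≠ 0)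
    (hu : partZ u = 0) (hv : partZ v = 0) {r : S k} (hr : r.IsHomogeneous 1) (i : Fin 2)
    (hrv : wedge (partX v) (partX u) = 0 ∨ eval v r = 0) :
    wedge (partY X) (C ∘ partX u) * (r * X (Fin.castLE (by omega) i)) ∈
      Ideal.span (cubics P u v) ⊔ Ideal.span {quad X} := by
  refine sub_mem_span_cubics hN hP hu hv ?_ ⟨fun w h2 h3 => ?_, fun w h0 h1 => ?_⟩ ?_ ?_
  · have hl : (wedge (partY X) (C ∘ partX u) : S k).IsHomogeneous 1 :=
      isHomogeneous_wedge isHomogeneous_partY fun i => isHomogeneous_C _ (partX u i)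
    exact hl.mul (hr.mul (isHomogeneous_X _ _))
  · simp [wedge, partY, h2, h3]
  · fin_cases i
    · simp [h0]
    · simp [h1]
  · obtain ⟨h2, h3⟩ := eq_neg_of_partZ_eq_zero hu
    simp [wedge, partY, partX, h2, h3]
    left
    ring
  · obtain ⟨h2, h3⟩ := eq_neg_of_partZ_eq_zero hv
    rcases hrv with h | h
    · simp only [wedge, partX, Matrix.cons_val_zero, Matrix.cons_val_one] at h
      simp [wedge, partY, partX, h2, h3]
      left
      linear_combination -h
    · simp [h]

/-- It suffices to find an element of K vanishing on the axes with the same restriction to z = 0 as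
f, because the difference then vanishes on all three lines. -/
theorem mem_span_cubics_sup_of_isHomogeneous [Infinite k] (hN : N * P.transpose = 1)
    (hP : ∀ i, quad (P i) ≠ 0) (hu : partZ u = 0) (hv : partZ v = 0) (hu0 : partX u ≠ 0)
    (hv0 : partX v ≠ 0) {n : ℕ} {f : S k} (hf : f.IsHomogeneous (n + 3)) (hax : VanishesOnAxes f)
    (hfu : eval u f = 0) (hfv : eval v f = 0) :
    f ∈ Ideal.span (cubics P u v) ⊔ Ideal.span {quad X} := by
  set K := Ideal.span (cubics P u v) ⊔ Ideal.span {quad X}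
  have hZ : ∀ w : Fin 4 → k, partZ w = 0 → ![w 0, w 1, -w 0, -w 1] = w := fun w hw => by
    obtain ⟨h2, h3⟩ := eq_neg_of_partZ_eq_zero hw
    funext i
    fin_cases i <;> simp [h2, h3]
  have hq : quad X ∈ K := Ideal.mem_sup_right (Ideal.mem_span_singleton_self _)
  have eZ : ∀ w : Fin 4 → k, partZ w = 0 → ∀ i, eval w ((partZ X : Fin 2 → S k) i) = 0 :=
    fun w hw i => by
      rw [show eval w ((partZ X : Fin 2 → S k) i) = partZ w i by
        fin_cases i <;> simp [partZ], hw]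
      rfl
  have hK : ∀ i j l, partX X i * partY X j * partZ X l ∈ K := fun i j l =>
    sub_mem_span_cubics hN hP hu hv (((isHomogeneous_partX i).mul (isHomogeneous_partY j)).mul
      (isHomogeneous_partZ l))
      (vanishesOnAxes_mul_left (vanishesOnAxes_X_mul_X i j) _)
      (by rw [map_mul, eZ u hu, mul_zero]) (by rw [map_mul, eZ v hv, mul_zero])
  obtain ⟨F1, hF1, hr1, hF⟩ := exists_eq_wedge_mul (n := n + 2) (isHomogeneous_restrictZ hf)
    (restrictZ_restrictZ f) hu hu0 (by rw [eval_restrictZ, hZ u hu, hfu])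
  have main : ∀ (r : S k) (G : Fin 2 → S k), r.IsHomogeneous 1 →
      (wedge (partX v) (partX u) = 0 ∨ eval v r = 0) → ∃ g ∈ K, VanishesOnAxes g ∧
        restrictZ g = wedge (partX X) (C ∘ partX u) * (restrictZ r *
          (X 0 * restrictZ (G 0) + X 1 * restrictZ (G 1))) := by
    intro r G hr hrv
    have hva : ∀ i : Fin 2, VanishesOnAxes
        (wedge (partY X) (C ∘ partX u) * (r * X (Fin.castLE (by omega) i))) := by
      refine fun i => ⟨fun w h2 h3 => ?_, fun w h0 h1 => ?_⟩
      · simp [wedge, partY, h2, h3]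
      · fin_cases i
        · simp [h0]
        · simp [h1]
    refine ⟨-(wedge (partY X) (C ∘ partX u) * (r * X 0) * G 0 +
      wedge (partY X) (C ∘ partX u) * (r * X 1) * G 1), ?_, ?_, ?_⟩
    · exact K.neg_mem (K.add_mem (K.mul_mem_right _ (wedge_mul_mem hN hP hu hv hr 0 hrv))
        (K.mul_mem_right _ (wedge_mul_mem hN hP hu hv hr 1 hrv)))
    · exact vanishesOnAxes_neg (vanishesOnAxes_add (vanishesOnAxes_mul_left (hva 0) _)
        (vanishesOnAxes_mul_left (hva 1) _))
    · have h1 : restrictZ (wedge (partY X) (C ∘ partX u) : S k) =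
          -wedge (partX X) (C ∘ partX u) := by
        simp [restrictZ, wedge, partX, partY]; ring
      have h2 : restrictZ (X 0 : S k) = X 0 := by simp [restrictZ]
      have h3 : restrictZ (X 1 : S k) = X 1 := by simp [restrictZ]
      simp only [map_neg, map_add, map_mul, h1, h2, h3]
      ring
  have fin : (∃ g ∈ K, VanishesOnAxes g ∧ restrictZ g = restrictZ f) → f ∈ K := by
    rintro ⟨g, hg, hga, hgf⟩
    have : f + -g ∈ K := mem_of_restrictZ_eq_zero hq hK
      (vanishesOnAxes_add hax (vanishesOnAxes_neg hga)) (by rw [map_add, map_neg, hgf, add_neg_cancel])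
    simpa using K.add_mem this hg
  apply fin
  -- If u and v are the same point, only one linear factor splits off and the free linear factor r
  -- is taken to be each variable in turn; otherwise r is the equation of v.
  by_cases hw : wedge (partX v) (partX u) = 0
  · obtain ⟨G, hG, hrG, hFG⟩ := exists_eq_X_mul_add hF1 hr1
    obtain ⟨G0, -, hr0, hF0⟩ := exists_eq_X_mul_add (hG 0) (hrG 0)
    obtain ⟨G1, -, hr1, hF1⟩ := exists_eq_X_mul_add (hG 1) (hrG 1)
    obtain ⟨g0, hg0, ha0, hz0⟩ := main (X 0) G0 (isHomogeneous_X _ _) (Or.inl hw)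
    obtain ⟨g1, hg1, ha1, hz1⟩ := main (X 1) G1 (isHomogeneous_X _ _) (Or.inl hw)
    refine ⟨g0 + g1, K.add_mem hg0 hg1, vanishesOnAxes_add ha0 ha1, ?_⟩
    rw [map_add, hz0, hz1, hF, hFG, hF0, hF1, hr0, hr0, hr1, hr1,
      show restrictZ (X 0 : S k) = X 0 by simp [restrictZ],
      show restrictZ (X 1 : S k) = X 1 by simp [restrictZ]]
    ring
  · obtain ⟨F2, hF2, hr2, hFF⟩ := exists_eq_wedge_mul (n := n + 1) hF1 hr1 hv hv0 (by
      have h := congrArg (eval v) hF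
      rw [eval_restrictZ, hZ v hv, hfv, map_mul, eq_comm, mul_eq_zero] at h
      refine h.resolve_left ?_
      convert! hw using 1
      simp [wedge, partX])
    obtain ⟨G, -, hrG, hFG⟩ := exists_eq_X_mul_add hF2 hr2
    obtain ⟨g, hg, ha, hz⟩ := main (wedge (partX X) (C ∘ partX v)) G
      (isHomogeneous_wedge isHomogeneous_partX fun i => isHomogeneous_C _ (partX v i)) (Or.inr (by
        simp [wedge, partX]; ring))
    refine ⟨g, hg, ha, ?_⟩
    rw [hz, hF, hFF, hFG, hrG, hrG, restrictZ_wedge]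

end

/-! ### Low degrees and the theorem in coordinates. -/

/-- Evaluation at four pairs is an endomorphism of the four-dimensional space of bilinear forms, so
injectivity gives surjectivity. -/
theorem exists_bil_eq_ite {s t : Fin 4 → Fin 2 → k}
    (h : ∀ M : Fin 4 → k, (∀ r, bil M (s r) (t r) = 0) → M = 0) :
    ∃ A : Fin 4 → Fin 4 → k, ∀ i r, bil (A i) (s r) (t r) = if i = r then 1 else 0 := by
  let L : (Fin 4 → k) →ₗ[k] (Fin 4 → k) :=
    { toFun := fun M r => bil M (s r) (t r)
      map_add' := fun M M' => by funext r; simp [bil]; ring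
      map_smul' := fun c M => by funext r; simp [bil]; ring }
  have hL : Function.Injective L := by
    rw [injective_iff_map_eq_zero]
    exact fun M hM => h M fun r => congrFun hM r
  have hs := LinearMap.injective_iff_surjective.1 hL
  choose A hA using fun i : Fin 4 => hs (fun r => if i = r then 1 else 0)
  exact ⟨A, fun i r => congrFun (hA i) r⟩

theorem eq_bil_of_isHomogeneous_two [Infinite k] {f : S k} (hf : f.IsHomogeneous 2)
    (hax : VanishesOnAxes f) :
    ∃ M : Fin 4 → k, f = bil (C ∘ M) (partX X) (partY X) := by
  obtain ⟨g, hg⟩ := exists_eq_of_vanishesOnAxes hax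
  have hX : ∀ i j : Fin 4, (X i * X j : S k).IsHomogeneous 2 := fun i j =>
    (isHomogeneous_X _ _).mul (isHomogeneous_X _ _)
  have hf' := homogeneousComponent_eq_self hf
  rw [hg] at hf'
  simp only [map_add, homogeneousComponent_mul_of_isHomogeneous (hX _ _), le_refl, if_true,
    Nat.sub_self, homogeneousComponent_zero] at hf'
  rw [← hg] at hf'
  refine ⟨![coeff 0 (g 0 0), coeff 0 (g 0 1), coeff 0 (g 1 0), coeff 0 (g 1 1)], ?_⟩
  rw [← hf']
  simp [bil, partX, partY]
  ring

theorem eq_zero_of_isHomogeneous_lt_two [Infinite k] {d : ℕ} (hd : d < 2) {f : S k}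
    (hf : f.IsHomogeneous d) (hax : VanishesOnAxes f) : f = 0 := by
  obtain ⟨g, hg⟩ := exists_eq_of_vanishesOnAxes hax
  have hX : ∀ i j : Fin 4, (X i * X j : S k).IsHomogeneous 2 := fun i j =>
    (isHomogeneous_X _ _).mul (isHomogeneous_X _ _)
  rw [← homogeneousComponent_eq_self hf, hg]
  simp only [map_add, homogeneousComponent_mul_of_isHomogeneous (hX _ _), if_neg (not_le.2 hd),
    add_zero]

/-- The generation statement in coordinates where the three lines are `x = 0`, `y = 0` and
`x + y = 0`. -/
theorem mem_span_cubics [Infinite k] {P : Fin 4 → Fin 4 → k} (hlin : LinearIndependent k P)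
    (hP : ∀ i, quad (P i) ≠ 0)
    (hyz : ∀ M : Fin 4 → k, (∀ r, bil M (partY (P r)) (partZ (P r)) = 0) → M = 0)
    (hxz : ∀ M : Fin 4 → k, (∀ r, bil M (partX (P r)) (partZ (P r)) = 0) → M = 0)
    (hxy : ∀ M : Fin 4 → k, (∀ r, bil M (partX (P r)) (partY (P r)) = 0) → M = 0)
    {u v : Fin 4 → k} (hu : partZ u = 0) (hv : partZ v = 0) (hu0 : partX u ≠ 0)
    (hv0 : partX v ≠ 0) {d : ℕ} {f : S k} (hf : f.IsHomogeneous d) (hax : VanishesOnAxes f)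
    (hfP : ∀ i, eval (P i) f = 0) (hfu : eval u f = 0) (hfv : eval v f = 0) :
    f ∈ Ideal.span (cubics P u v) := by
  rcases le_or_gt d 2 with hd | hd
  · suffices f = 0 by rw [this]; exact zero_mem _
    rcases hd.lt_or_eq with hd | rfl
    · exact eq_zero_of_isHomogeneous_lt_two hd hf hax
    · obtain ⟨M, rfl⟩ := eq_bil_of_isHomogeneous_two hf hax
      have hM := hxy M fun r => by
        rw [← hfP r, eval_bil, eval_partX, eval_partY]
      simp [hM, bil]
  obtain ⟨n, rfl⟩ := Nat.exists_eq_add_of_lt hd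
  obtain ⟨N, hN⟩ : ∃ N : Matrix (Fin 4) (Fin 4) k, N * (Matrix.of P).transpose = 1 := by
    have := (Matrix.linearIndependent_rows_iff_isUnit (A := Matrix.of P)).1 hlin
    have h2 : IsUnit (Matrix.of P).transpose := (Matrix.isUnit_transpose _).2 this
    exact h2.exists_left_inv
  have hmem := mem_span_cubics_sup_of_isHomogeneous (P := Matrix.of P) (n := n) hN hP hu hv hu0 hv0
    (by convert! hf using 1; omega) hax hfu hfv
  obtain ⟨g, hg, q, hq, hgq⟩ := Submodule.mem_sup.1 hmem
  obtain ⟨c, rfl⟩ := Ideal.mem_span_singleton'.1 hq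
  have hres : ∀ (e : S k) (m : ℕ), e.IsHomogeneous m → (∀ i, eval (P i) e = 0) →
      ∀ i, restrictPoint (Matrix.of P) N i e = 0 := fun e m he heP i =>
    MvPolynomial.funext fun w => by
      rw [eval_restrictPoint, eval_smul_of_isHomogeneous he, map_zero]
      exact mul_eq_zero_of_right _ (heP i)
  have hgres : ∀ i, restrictPoint (Matrix.of P) N i g = 0 := fun i => by
    have : Ideal.span (cubics (Matrix.of P) u v) ≤ RingHom.ker (restrictPoint (Matrix.of P) N i) :=
      Ideal.span_le.2 fun e he => hres e 3 he.1 he.2.2.1 i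
    exact this hg
  -- On the line through P_i the ring is a domain and q restricts to a nonzero polynomial, so c q =
  -- f - g forces c to restrict to zero.
  have hcres : ∀ i, restrictPoint (Matrix.of P) N i c = 0 := fun i => by
    have h := congrArg (restrictPoint (Matrix.of P) N i) hgq
    rw [map_add, hgres, map_mul, hres f _ hf hfP, zero_add, mul_eq_zero] at h
    refine h.resolve_right fun h0 => hP i ?_
    have := congrArg (eval (P i)) h0
    rw [eval_restrictPoint] at this
    have h1 := eval_linForm_of_mul_eq_one hN i i
    rw [if_pos rfl] at h1
    rw [show eval (P i) (linForm (N i)) = 1 from h1, one_smul] at this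
    simpa [quad] using this
  have hc0 : eval 0 c = 0 := by
    have := congrArg (eval 0) (hcres 0)
    rwa [eval_restrictPoint, show eval (0 : Fin 4 → k) (linForm (N 0)) = 0 by simp [linForm],
      zero_smul, map_zero] at this
  have hc := mem_span_of_restrictPoint_eq_zero hN hc0 hcres
  obtain ⟨A, hA⟩ := exists_bil_eq_ite hyz
  obtain ⟨B, hB⟩ := exists_bil_eq_ite hxz
  obtain ⟨D, hD⟩ := exists_bil_eq_ite hxy
  rw [← hgq]
  refine Ideal.add_mem _ hg ?_
  refine Submodule.span_induction
    (p := fun c _ => c * quad X ∈ Ideal.span (cubics (Matrix.of P) u v)) ?_ ?_ ?_ ?_ hc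
  · rintro _ ⟨i, j, hij, rfl⟩
    rw [mul_comm]
    exact quad_mul_linForm_mul_linForm_mem hN hA hB hD hu hv hij
  · simp
  · intro a b _ _ ha hb
    rw [add_mul]
    exact Ideal.add_mem _ ha hb
  · intro a b _ hb
    rw [smul_eq_mul, mul_assoc]
    exact Ideal.mul_mem_left _ _ hb

/-! ### Change of coordinates and passage from projective points to vectors. -/

/-- The substitution of a linear map into polynomials. -/
noncomputable def linSubst {n : Type*} [Fintype n] [DecidableEq n] (L : (n → k) →ₗ[k] (n → k)) :
    MvPolynomial n k →ₐ[k] MvPolynomial n k :=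
  bind₁ fun i => linForm fun j => L (Pi.single j 1) i

theorem eval_linSubst {n : Type*} [Fintype n] [DecidableEq n] (L : (n → k) →ₗ[k] (n → k))
    (v : n → k) (f : MvPolynomial n k) : eval v (linSubst L f) = eval (L v) f := by
  rw [linSubst, eval_bind₁]
  congr 2
  funext i
  rw [eval_linForm]
  conv_rhs => rw [L.pi_apply_eq_sum_univ v, Finset.sum_apply]
  refine Finset.sum_congr rfl fun m _ => ?_
  rw [mul_comm, Pi.smul_apply, smul_eq_mul]
  refine congrArg (fun w => v m * L w i) (funext fun j => ?_)
  simp [Pi.single_apply, eq_comm]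

theorem isHomogeneous_linSubst {n : Type*} [Fintype n] [DecidableEq n]
    (L : (n → k) →ₗ[k] (n → k)) {d : ℕ} {f : MvPolynomial n k} (hf : f.IsHomogeneous d) :
    (linSubst L f).IsHomogeneous d := by
  have := hf.aeval (S := k) (fun i => linForm fun j => L (Pi.single j 1) i) (n := 1)
    fun i => isHomogeneous_linForm _
  rwa [one_mul] at this

theorem vanishesAt_iff {f : S k} {d : ℕ} (hf : f.IsHomogeneous d) (p : P3 k) :
    VanishesAt f p ↔ eval p.rep f = 0 := by
  rw [VanishesAt, Projectivization.submodule_eq]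
  refine ⟨fun h => h _ (Submodule.mem_span_singleton_self _), fun h v hv => ?_⟩
  obtain ⟨t, rfl⟩ := Submodule.mem_span_singleton.1 hv
  rw [eval_smul_of_isHomogeneous hf, h, mul_zero]

theorem rep_mem_submodule_iff {L : Projectivization.Subspace k (Fin 4 → k)} {p : P3 k} :
    p.rep ∈ Projectivization.Subspace.submodule L ↔ p ∈ L := by
  rw [Projectivization.Subspace.mem_submodule_iff L p.rep_nonzero, Projectivization.mk_rep]

/-- The auxiliary point p serves only to give vanishing at the zero vector, which represents no
projective point. -/
theorem eval_eq_zero_of_mem_submodule {f : S k} {L : Projectivization.Subspace k (Fin 4 → k)}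
    (hL : ∀ p ∈ L, VanishesAt f p) {p : P3 k} (hp : VanishesAt f p) {v : Fin 4 → k}
    (hv : v ∈ Projectivization.Subspace.submodule L) : eval v f = 0 := by
  by_cases h0 : v = 0
  · rw [h0]; exact hp 0 (zero_mem _)
  · refine hL (Projectivization.mk k v h0)
      ((Projectivization.Subspace.mem_submodule_iff L h0).1 hv) v ?_
    rw [Projectivization.submodule_mk]
    exact Submodule.mem_span_singleton_self _

theorem disjoint_submodule {L M : Projectivization.Subspace k (Fin 4 → k)}
    (h : Disjoint (L : Set (P3 k)) (M : Set (P3 k))) {v : Fin 4 → k}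
    (hL : v ∈ Projectivization.Subspace.submodule L)
    (hM : v ∈ Projectivization.Subspace.submodule M) : v = 0 := by
  by_contra h0
  rw [Projectivization.Subspace.mem_submodule_iff _ h0] at hL hM
  exact Set.disjoint_left.1 h hL hM

/-- Three mutually disjoint lines in projective `3`-space become the lines `z = 0`, `y = 0` and
`x = 0` in suitable coordinates. -/
theorem exists_linearEquiv_of_lines {V₁ V₂ V₃ : Submodule k (Fin 4 → k)}
    (h₁ : Module.finrank k V₁ = 2) (h₂ : Module.finrank k V₂ = 2) (h₃ : Module.finrank k V₃ = 2)
    (h₁₂ : ∀ v ∈ V₁, v ∈ V₂ → v = 0) (h₁₃ : ∀ v ∈ V₁, v ∈ V₃ → v = 0)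
    (h₂₃ : ∀ v ∈ V₂, v ∈ V₃ → v = 0) :
    ∃ e : (Fin 4 → k) ≃ₗ[k] (Fin 4 → k), (∀ c, e c ∈ V₁ ↔ partZ c = 0) ∧
      (∀ c, e c ∈ V₂ ↔ partY c = 0) ∧ ∀ c, e c ∈ V₃ ↔ partX c = 0 := by
  have hpair : ∀ a b : k, ((![a, b] : Fin 2 → k) = 0 ↔ a = 0 ∧ b = 0) := fun a b => by
    simp [funext_iff, Fin.forall_fin_two]
  have htop : V₂ ⊔ V₃ = ⊤ := Submodule.eq_top_of_disjoint _ _ (by simp [h₂, h₃])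
    (Submodule.disjoint_def.2 h₂₃)
  let r := Module.finBasisOfFinrankEq k V₁ h₁
  have hr : ∀ a b : k, a • (r 0 : Fin 4 → k) + b • (r 1 : Fin 4 → k) = 0 → a = 0 ∧ b = 0 := by
    intro a b hab
    have := Fintype.linearIndependent_iff.1 r.linearIndependent ![a, b] (by
      rw [Fin.sum_univ_two]
      exact Subtype.ext hab)
    exact ⟨this 0, this 1⟩
  have hdec : ∀ i, ∃ s ∈ V₂, ∃ t ∈ V₃, s + t = (r i : Fin 4 → k) := fun i =>
    Submodule.mem_sup.1 (htop ▸ Submodule.mem_top)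
  choose s hs t ht hst using hdec
  have hs0 : ∀ a b : k, a • s 0 + b • s 1 ∈ V₃ → a = 0 ∧ b = 0 := fun a b h => by
    refine hr a b (h₁₃ _ (V₁.add_mem (V₁.smul_mem _ (r 0).2) (V₁.smul_mem _ (r 1).2)) ?_)
    rw [← hst, ← hst]
    have := V₃.add_mem h (V₃.add_mem (V₃.smul_mem a (ht 0)) (V₃.smul_mem b (ht 1)))
    convert! this using 1
    module
  have ht0 : ∀ a b : k, a • t 0 + b • t 1 ∈ V₂ → a = 0 ∧ b = 0 := fun a b h => by
    refine hr a b (h₁₂ _ (V₁.add_mem (V₁.smul_mem _ (r 0).2) (V₁.smul_mem _ (r 1).2)) ?_)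
    rw [← hst, ← hst]
    have := V₂.add_mem h (V₂.add_mem (V₂.smul_mem a (hs 0)) (V₂.smul_mem b (hs 1)))
    convert! this using 1
    module
  have ht1 : ∀ a b : k, a • t 0 + b • t 1 ∈ V₁ → a = 0 ∧ b = 0 := fun a b h => by
    have h0 := h₁₃ _ h (V₃.add_mem (V₃.smul_mem a (ht 0)) (V₃.smul_mem b (ht 1)))
    exact ht0 a b (h0 ▸ V₂.zero_mem)
  -- A basis r of V₁ splits as r_i = s_i + t_i along V₂ ⊕ V₃; the minus sign makes V₁ the locus y =
  -- -x, that is, z = 0.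
  let E : (Fin 4 → k) →ₗ[k] (Fin 4 → k) :=
    { toFun := fun c => (c 0 • s 0 + c 1 • s 1) - (c 2 • t 0 + c 3 • t 1)
      map_add' := fun c d => by simp only [Pi.add_apply]; module
      map_smul' := fun a c => by simp only [Pi.smul_apply, RingHom.id_apply, smul_eq_mul]; module }
  have hsm : ∀ a b : k, a • s 0 + b • s 1 ∈ V₂ := fun a b =>
    V₂.add_mem (V₂.smul_mem _ (hs 0)) (V₂.smul_mem _ (hs 1))
  have htm : ∀ a b : k, a • t 0 + b • t 1 ∈ V₃ := fun a b =>
    V₃.add_mem (V₃.smul_mem _ (ht 0)) (V₃.smul_mem _ (ht 1))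
  have e2 : ∀ c, E c ∈ V₂ ↔ partY c = 0 := fun c => by
    rw [partY, hpair]
    refine ⟨fun h => ht0 _ _ ((V₂.sub_mem_iff_right (hsm _ _)).1 h), fun h => ?_⟩
    exact (V₂.sub_mem_iff_right (hsm _ _)).2 (by simp [h.1, h.2])
  have e3 : ∀ c, E c ∈ V₃ ↔ partX c = 0 := fun c => by
    rw [partX, hpair]
    refine ⟨fun h => hs0 _ _ ((V₃.sub_mem_iff_left (htm _ _)).1 h), fun h => ?_⟩
    exact (V₃.sub_mem_iff_left (htm _ _)).2 (by simp [h.1, h.2])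
  have e1 : ∀ c, E c ∈ V₁ ↔ partZ c = 0 := fun c => by
    rw [partZ, hpair, neg_eq_zero, neg_eq_zero]
    have hE : E c = (c 0 • (r 0 : Fin 4 → k) + c 1 • (r 1 : Fin 4 → k)) -
        ((c 0 + c 2) • t 0 + (c 1 + c 3) • t 1) := by
      change (c 0 • s 0 + c 1 • s 1) - (c 2 • t 0 + c 3 • t 1) = _
      rw [← hst, ← hst]
      module
    have hm := V₁.add_mem (V₁.smul_mem (c 0) (r 0).2) (V₁.smul_mem (c 1) (r 1).2)
    rw [hE, V₁.sub_mem_iff_right hm]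
    exact ⟨fun h => ht1 _ _ h, fun h => by simp [h.1, h.2]⟩
  have hinj : Function.Injective E := by
    rw [injective_iff_map_eq_zero]
    intro c hc
    have hx := (e3 c).1 (hc ▸ V₃.zero_mem)
    have hy := (e2 c).1 (hc ▸ V₂.zero_mem)
    rw [partX, hpair] at hx
    rw [partY, hpair] at hy
    funext i
    fin_cases i
    exacts [hx.1, hx.2, hy.1, hy.2]
  exact ⟨LinearEquiv.ofInjectiveEndo E hinj, e1, e2, e3⟩

/-- Representatives of four points not contained in a plane are linearly independent. -/
theorem linearIndependent_rep {p : Fin 4 → P3 k}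
    (h : ¬ ∃ H : Projectivization.Subspace k (Fin 4 → k), IsPlane H ∧
      Set.range p ⊆ (H : Set (P3 k))) : LinearIndependent k fun i => (p i).rep := by
  refine linearIndependent_of_top_le_span_of_card_eq_finrank ?_ (by simp)
  by_contra hlt
  obtain ⟨φ, hφ, hle⟩ := Submodule.exists_le_ker_of_lt_top _ (lt_top_iff_ne_top.2 fun h => hlt h.ge)
  refine h ⟨(LinearMap.ker φ).projectivization, ?_, ?_⟩
  · have := LinearMap.finrank_range_add_finrank_ker φ
    rw [LinearMap.range_eq_top.2 (LinearMap.surjective hφ), finrank_top, Module.finrank_self,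
      Module.finrank_fin_fun] at this
    rw [IsPlane, OrderIso.apply_symm_apply]
    omega
  · rintro _ ⟨i, rfl⟩
    rw [SetLike.mem_coe, ← rep_mem_submodule_iff, OrderIso.apply_symm_apply]
    exact hle (Submodule.subset_span ⟨i, rfl⟩)

theorem eq_zero_of_bil_eq_zero {M : Fin 4 → k} (h : ∀ s t : Fin 2 → k, bil M s t = 0) : M = 0 := by
  funext i
  fin_cases i
  · simpa [bil] using h ![1, 0] ![1, 0]
  · simpa [bil] using h ![1, 0] ![0, 1]
  · simpa [bil] using h ![0, 1] ![1, 0]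
  · simpa [bil] using h ![0, 1] ![0, 1]

/-- A bilinear form in (x, y) vanishing for y = -x is alternating, hence a multiple of the
determinant. Three values of x suffice to test this. -/
theorem eval_eq_mul_quad [Infinite k] {f : S k} (hf : f.IsHomogeneous 2) (hax : VanishesOnAxes f)
    (hz : ∀ c : Fin 4 → k, partZ c = 0 → eval c f = 0) :
    ∃ a : k, ∀ c, eval c f = a * quad c := by
  obtain ⟨M, rfl⟩ := eq_bil_of_isHomogeneous_two hf hax
  have h0 := hz ![1, 0, -1, 0] (by funext i; fin_cases i <;> simp [partZ])
  have h1 := hz ![0, 1, 0, -1] (by funext i; fin_cases i <;> simp [partZ])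
  have h2 := hz ![1, 1, -1, -1] (by funext i; fin_cases i <;> simp [partZ])
  simp only [eval_bil, eval_partX, eval_partY] at h0 h1 h2 ⊢
  simp [bil, partX, partY] at h0 h1 h2
  refine ⟨M 1, fun c => ?_⟩
  simp only [bil, partX, partY, quad, Matrix.cons_val_zero, Matrix.cons_val_one, h0, h1]
  rw [h0, h1] at h2
  linear_combination -(c 1 * c 2) * h2

end LinesAndPoints


/-! ### The theorem in projective space. -/

theorem corollaryB2 {k : Type*} [Field k] [IsAlgClosed k] [CharZero k]
    (L₁ L₂ L₃ : Projectivization.Subspace k (Fin 4 → k))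
    (hL₁ : LinesAndPoints.IsLine L₁) (hL₂ : LinesAndPoints.IsLine L₂)
    (hL₃ : LinesAndPoints.IsLine L₃)
    (h₁₂ : Disjoint (L₁ : Set (LinesAndPoints.P3 k)) (L₂ : Set (LinesAndPoints.P3 k)))
    (h₁₃ : Disjoint (L₁ : Set (LinesAndPoints.P3 k)) (L₃ : Set (LinesAndPoints.P3 k)))
    (h₂₃ : Disjoint (L₂ : Set (LinesAndPoints.P3 k)) (L₃ : Set (LinesAndPoints.P3 k)))
    (Y : Set (LinesAndPoints.P3 k))
    (hY : Y = (L₁ : Set (LinesAndPoints.P3 k)) ∪ (L₂ : Set (LinesAndPoints.P3 k)) ∪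
      (L₃ : Set (LinesAndPoints.P3 k)))
    (P₀ P₁ P₂ P₃ : LinesAndPoints.P3 k)
    (W : Set (LinesAndPoints.P3 k)) (hW : W = {P₀, P₁, P₂, P₃})
    (hplane : ¬ ∃ H : Projectivization.Subspace k (Fin 4 → k),
      LinesAndPoints.IsPlane H ∧ W ⊆ (H : Set (LinesAndPoints.P3 k)))
    (Q : Set (LinesAndPoints.P3 k)) (hQ : LinesAndPoints.IsQuadricSurface Q) (hYQ : Y ⊆ Q)
    (hWQ : ∀ p ∈ W, p ∉ Q)
    (hH₁ : LinesAndPoints.formsVanishingOn ((Y \ (L₁ : Set (LinesAndPoints.P3 k))) ∪ W) 2 = ⊥)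
    (hH₂ : LinesAndPoints.formsVanishingOn ((Y \ (L₂ : Set (LinesAndPoints.P3 k))) ∪ W) 2 = ⊥)
    (hH₃ : LinesAndPoints.formsVanishingOn ((Y \ (L₃ : Set (LinesAndPoints.P3 k))) ∪ W) 2 = ⊥)
    (P₄ P₅ : LinesAndPoints.P3 k) (hP₄ : P₄ ∈ L₁) (hP₅ : P₅ ∈ L₁) :
    LinesAndPoints.IsGeneratedByForms
      (LinesAndPoints.homogeneousIdeal
        ((L₂ : Set (LinesAndPoints.P3 k)) ∪ (L₃ : Set (LinesAndPoints.P3 k)) ∪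
          {P₀, P₁, P₂, P₃, P₄, P₅})) 3 := by
  open LinesAndPoints MvPolynomial in
  have : Infinite k := IsAlgClosed.instInfinite
  let p : Fin 4 → P3 k := ![P₀, P₁, P₂, P₃]
  have hWp : W = Set.range p := by
    rw [hW]
    ext x
    simp [p]
    tauto
  obtain ⟨e, e1, e2, e3⟩ := exists_linearEquiv_of_lines hL₁ hL₂ hL₃
    (fun v => disjoint_submodule h₁₂) (fun v => disjoint_submodule h₁₃)
    (fun v => disjoint_submodule h₂₃)
  have hmem : ∀ x : P3 k, e (e.symm x.rep) = x.rep := fun x => e.apply_symm_apply _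
  have m1 : ∀ x : P3 k, x ∈ L₁ ↔ partZ (e.symm x.rep) = 0 := fun x => by
    rw [← e1, hmem, rep_mem_submodule_iff]
  have m2 : ∀ x : P3 k, x ∈ L₂ ↔ partY (e.symm x.rep) = 0 := fun x => by
    rw [← e2, hmem, rep_mem_submodule_iff]
  have m3 : ∀ x : P3 k, x ∈ L₃ ↔ partX (e.symm x.rep) = 0 := fun x => by
    rw [← e3, hmem, rep_mem_submodule_iff]
  have hpX : ∀ c : Fin 4 → k, c 0 = 0 → c 1 = 0 → partX c = 0 := fun c h0 h1 => by
    funext i; fin_cases i <;> simp [partX, h0, h1]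
  have hpY : ∀ c : Fin 4 → k, c 2 = 0 → c 3 = 0 → partY c = 0 := fun c h2 h3 => by
    funext i; fin_cases i <;> simp [partY, h2, h3]
  let P : Fin 4 → Fin 4 → k := fun i => e.symm (p i).rep
  have hrep : LinearIndependent k fun i => (p i).rep := linearIndependent_rep (by rwa [← hWp])
  have hlin : LinearIndependent k P := by
    have := hrep.map' e.symm.toLinearMap e.symm.ker
    exact this
  have hP : ∀ i, quad (P i) ≠ 0 := by
    obtain ⟨q, -, hq2, hqQ⟩ := hQ
    intro i hi
    have hq : ∀ x ∈ Y, VanishesAt q x := fun x hx => by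
      have := hYQ hx
      rwa [hqQ] at this
    have hx : VanishesAt q P₄ := hq _ (by rw [hY]; exact Or.inl (Or.inl hP₄))
    obtain ⟨a, ha⟩ := eval_eq_mul_quad (isHomogeneous_linSubst e.toLinearMap hq2)
      ⟨fun c h2 h3 => by
        rw [eval_linSubst]
        exact eval_eq_zero_of_mem_submodule (fun y hy => hq y (by rw [hY]; exact Or.inl (Or.inr hy)))
          hx ((e2 c).2 (hpY c h2 h3)),
      fun c h0 h1 => by
        rw [eval_linSubst]
        exact eval_eq_zero_of_mem_submodule (fun y hy => hq y (by rw [hY]; exact Or.inr hy))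
          hx ((e3 c).2 (hpX c h0 h1))⟩
      (fun c hc => by
        rw [eval_linSubst]
        exact eval_eq_zero_of_mem_submodule (fun y hy => hq y (by rw [hY]; exact Or.inl (Or.inl hy)))
          hx ((e1 c).2 hc))
    refine hWQ (p i) (hWp ▸ ⟨i, rfl⟩) ?_
    have := ha (P i)
    rw [hi, mul_zero, eval_linSubst] at this
    rw [hqQ]
    refine (vanishesAt_iff hq2 _).2 ?_
    rwa [← hmem]
  have key : ∀ (Z : Set (P3 k)), formsVanishingOn Z 2 = ⊥ → ∀ f : S k, f.IsHomogeneous 2 →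
      (∀ x ∈ Z, eval (e.symm x.rep) f = 0) → ∀ c, eval c f = 0 := by
    intro Z hZ f hf hfZ c
    have hfe := isHomogeneous_linSubst e.symm.toLinearMap hf
    have hm : linSubst e.symm.toLinearMap f ∈ formsVanishingOn Z 2 :=
      ⟨hfe, fun x hx => (vanishesAt_iff hfe x).2 (by
        rw [eval_linSubst]; exact hfZ x hx)⟩
    rw [hZ, Submodule.mem_bot] at hm
    have := congrArg (eval (e c)) hm
    rw [eval_linSubst, map_zero] at this
    simpa using this
  have hyz : ∀ M : Fin 4 → k, (∀ r, bil M (partY (P r)) (partZ (P r)) = 0) → M = 0 := by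
    intro M hM
    have h := key _ hH₃ (bil (C ∘ M) (partY X) (partZ X))
      (isHomogeneous_bil _ isHomogeneous_partY isHomogeneous_partZ) (by
        intro x hx
        rw [eval_bil, eval_partY, eval_partZ]
        rw [hY, hWp] at hx
        rcases hx with ⟨(hx | hx) | hx, hn⟩ | ⟨i, rfl⟩
        · simp [(m1 x).1 hx, bil]
        · simp [(m2 x).1 hx, bil]
        · exact absurd hx hn
        · exact hM i)
    refine eq_zero_of_bil_eq_zero fun s t => ?_
    -- The vector with y = s and z = t: any two of x, y, z are free coordinates.
    convert! h ![-(s 0 + t 0), -(s 1 + t 1), s 0, s 1] using 1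
    rw [eval_bil, eval_partY, eval_partZ]
    simp [bil, partY, partZ]
  have hxz : ∀ M : Fin 4 → k, (∀ r, bil M (partX (P r)) (partZ (P r)) = 0) → M = 0 := by
    intro M hM
    have h := key _ hH₂ (bil (C ∘ M) (partX X) (partZ X))
      (isHomogeneous_bil _ isHomogeneous_partX isHomogeneous_partZ) (by
        intro x hx
        rw [eval_bil, eval_partX, eval_partZ]
        rw [hY, hWp] at hx
        rcases hx with ⟨(hx | hx) | hx, hn⟩ | ⟨i, rfl⟩
        · simp [(m1 x).1 hx, bil]
        · exact absurd hx hn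
        · simp [(m3 x).1 hx, bil]
        · exact hM i)
    refine eq_zero_of_bil_eq_zero fun s t => ?_
    convert! h ![s 0, s 1, -(s 0 + t 0), -(s 1 + t 1)] using 1
    rw [eval_bil, eval_partX, eval_partZ]
    simp [bil, partX, partZ]
  have hxy : ∀ M : Fin 4 → k, (∀ r, bil M (partX (P r)) (partY (P r)) = 0) → M = 0 := by
    intro M hM
    have h := key _ hH₁ (bil (C ∘ M) (partX X) (partY X))
      (isHomogeneous_bil _ isHomogeneous_partX isHomogeneous_partY) (by
        intro x hx
        rw [eval_bil, eval_partX, eval_partY]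
        rw [hY, hWp] at hx
        rcases hx with ⟨(hx | hx) | hx, hn⟩ | ⟨i, rfl⟩
        · exact absurd hx hn
        · simp [(m2 x).1 hx, bil]
        · simp [(m3 x).1 hx, bil]
        · exact hM i)
    refine eq_zero_of_bil_eq_zero fun s t => ?_
    convert! h ![s 0, s 1, t 0, t 1] using 1
    rw [eval_bil, eval_partX, eval_partY]
    simp [bil, partX, partY]
  have hn : ∀ x ∈ L₁, partX (e.symm x.rep) ≠ 0 := fun x hx h =>
    Set.disjoint_left.1 h₁₃ hx ((m3 x).2 h)
  set Z : Set (P3 k) := (L₂ : Set (P3 k)) ∪ (L₃ : Set (P3 k)) ∪ {P₀, P₁, P₂, P₃, P₄, P₅} with hZ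
  have hpZ : ∀ i, p i ∈ Z := fun i => Or.inr (by fin_cases i <;> simp [p])
  refine ⟨(formsVanishingOn Z 3 : Set (S k)), fun g hg => hg.1, ?_⟩
  apply le_antisymm
  · rw [homogeneousIdeal, Ideal.span_le]
    rintro f ⟨d, hf, hfZ⟩
    have hv : ∀ x ∈ Z, eval (e.symm x.rep) (linSubst e.toLinearMap f) = 0 := fun x hx => by
      rw [eval_linSubst]
      exact (hmem x).symm ▸ (vanishesAt_iff hf x).1 (hfZ x hx)
    have h := mem_span_cubics hlin hP hyz hxz hxy ((m1 _).1 hP₄) ((m1 _).1 hP₅) (hn _ hP₄)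
      (hn _ hP₅) (isHomogeneous_linSubst e.toLinearMap hf)
      ⟨fun c h2 h3 => by
        rw [eval_linSubst]
        exact eval_eq_zero_of_mem_submodule (fun y hy => hfZ y (Or.inl (Or.inl hy)))
          (hfZ _ (hpZ 0)) ((e2 c).2 (hpY c h2 h3)),
      fun c h0 h1 => by
        rw [eval_linSubst]
        exact eval_eq_zero_of_mem_submodule (fun y hy => hfZ y (Or.inl (Or.inr hy)))
          (hfZ _ (hpZ 0)) ((e3 c).2 (hpX c h0 h1))⟩
      (fun i => hv _ (hpZ i)) (hv _ (Or.inr (by simp))) (hv _ (Or.inr (by simp)))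
    have h' := Ideal.mem_map_of_mem (linSubst e.symm.toLinearMap) h
    have hback : linSubst e.symm.toLinearMap (linSubst e.toLinearMap f) = f :=
      MvPolynomial.funext fun v => by
        rw [eval_linSubst, eval_linSubst]
        simp
    rw [hback, Ideal.map_span] at h'
    refine Ideal.span_mono ?_ h'
    rintro _ ⟨g, ⟨hg, ⟨hgy, hgx⟩, hgP, hg4, hg5⟩, rfl⟩
    have hge := isHomogeneous_linSubst e.symm.toLinearMap hg
    refine ⟨hge, fun x hx => (vanishesAt_iff hge x).2 ?_⟩
    rw [eval_linSubst]
    rcases hx with (hx | hx) | hx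
    · have := (m2 x).1 hx
      exact hgy _ (congrFun this 0) (congrFun this 1)
    · have := (m3 x).1 hx
      exact hgx _ (congrFun this 0) (congrFun this 1)
    · rcases hx with rfl | rfl | rfl | rfl | rfl | rfl
      exacts [hgP 0, hgP 1, hgP 2, hgP 3, hg4, hg5]
  · exact Ideal.span_mono fun g hg => ⟨3, hg⟩
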